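/- Let $r\ge 1$ be an integer. For $n\ge 0$ let $\mathfrak S_{n,r}=\mathbb Z_r\wr\mathfrak S_n$ be the group of $r$-colored permutations $w=w(1)^{c_1}\cdots w(n)^{c_n}$, with underlying permutation $w\in\mathfrak S_n$ and colors $c_i\in\{0,\dots,r-1\}$ (read modulo $r$); here $w$ acts on colored integers by $a^i\mapsto w(a)^{i+c_a}$, and the product is composition. Let $\overline w$ be $w$ with color vector $(-c_1,\dots,-c_n)$ modulo $r$; $w$ is an absolute involution if $\overline w^{\,-1}=w$, and $\mathcal I_n^{\rm abs}$ is the set of absolute involutions in $\mathfrak S_{n,r}$. Order the colored integers by $$1^{r-1}<\cdots<n^{r-1}<\cdots<1^1<\cdots<n^1<1^0<\cdots<n^0 .$$ Let $\mathrm{Des}^*(w)$ be the set of all $i\in\{1,\dots,n-1\}$ with $w(i)^{c_i}>w(i+1)^{c_{i+1}}$, and let $\mathrm{Des}(w)$ be $\mathrm{Des}^*(w)$ together with $0$ if $n\ge1$ and $c_1\ne0$. Put $\mathrm{des}(w)=|\mathrm{Des}(w)|$, $\mathrm{fmaj}(w)=r\sum_{i\in\mathrm{Des}(w)}i+\sum_{i=1}^n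 c_i$ and $\mathrm{fdes}(w)=r\,|\mathrm{Des}^*(w)|+c_1$ (with $\mathrm{fdes}=0$ for $n=0$), and let $\mathrm{fix}^j(w)$ be the number of $i$ with $w(i)=i$ and $c_i=j$. Define $$I_n(x,q,p_0,\dots,p_{r-1})=\sum_{w\in\mathcal I_n^{\rm abs}}x^{\mathrm{des}(w)}q^{\mathrm{fmaj}(w)}\prod_{j=0}^{r-1}p_j^{\mathrm{fix}^j(w)},\qquad I_n^{\rm flag}(x,q,p_0,\dots,p_{r-1})=\sum_{w\in\mathcal I_n^{\rm abs}}x^{\mathrm{fdes}(w)}q^{\mathrm{fmaj}(w)}\prod_{j=0}^{r-1}p_j^{\mathrm{fix}^j(w)},$$ so that $I_0=I_0^{\rm flag}=1$. Write $(a;q)_n=\prod_{k=0}^{n-1}(1-aq^k)$ and $[r]_x=1+x+\cdots+x^{r-1}$. Then, as formal power series in the indeterminates $x,q,z,p_0,\dots,p_{r-1}$ over any commutative ring (all infinite sums converge coefficientwise), $$\sum_{n\ge0}\frac{I_n(x,q,p_0,\dots,p_{r-1})}{(x;q^r)_{n+1}}\,z^n=\sum_{m\ge0}\frac{1}{(p_0z;q^r)_{m+1}}\prod_{0\le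 i<j\le m}\frac1{1-z^2q^{r(i+j)}}\;\prod_{c=1}^{r-1}\Bigl(\frac1{(p_cq^cz;q^r)_m}\prod_{0\le i<j\le m-1}\frac1{1-z^2q^{r(i+j)+2c}}\Bigr)x^m$$ and $$\sum_{n\ge0}\frac{[r]_x\,I_n^{\rm flag}(x,q,p_0,\dots,p_{r-1})}{(x^r;q^r)_{n+1}}\,z^n=\sum_{m\ge0}\frac{1}{(p_0z;q^r)_{\lfloor m/r\rfloor+1}}\prod_{0\le i<j\le\lfloor m/r\rfloor}\frac1{1-z^2q^{r(i+j)}}\;\prod_{c=1}^{r-1}\Bigl(\frac1{(p_cq^cz;q^r)_{\lfloor (m-c)/r\rfloor+1}}\prod_{0\le i<j\le\lfloor (m-c)/r\rfloor}\frac1{1-z^2q^{r(i+j)+2c}}\Bigr)x^m .$$ -/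

import Mathlib

open scoped MvPowerSeries.WithPiTopology

/-- An `r`-colored permutation of `n` letters in window notation
`w(1)^{c_1} ⋯ w(n)^{c_n}`: the underlying permutation and the color vector. Letters and
positions are `0, …, n - 1`, and the colors `Fin r` form the cyclic group of order `r`. -/
@[ext]
structure ColoredPerm (n r : ℕ) where
  perm : Equiv.Perm (Fin n)
  color : Fin n → Fin r

namespace ColoredPerm

variable {n r : ℕ}

/-- Colored permutations are pairs of a permutation and a color vector. -/
def equivProd (n r : ℕ) : ColoredPerm n r ≃ Equiv.Perm (Fin n) × (Fin n → Fin r) where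
  toFun w := (w.perm, w.color)
  invFun p := ⟨p.1, p.2⟩
  left_inv _ := rfl
  right_inv _ := rfl

instance : Fintype (ColoredPerm n r) := Fintype.ofEquiv _ (equivProd n r).symm

/-- The action on colored integers: `a^i ↦ w(a)^{i + c_a}`, colors modulo `r`. -/
def act (w : ColoredPerm n r) (a : Fin n × Fin r) : Fin n × Fin r :=
  (w.perm a.1, a.2 + w.color a.1)

/-- The group structure is composition of the maps `act w`, see `act_mul` and `act_one`. -/
instance [NeZero r] : Group (ColoredPerm n r) where
  mul w v := ⟨w.perm * v.perm, fun i => v.color i + w.color (v.perm i)⟩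
  one := ⟨1, fun _ => 0⟩
  inv w := ⟨w.perm⁻¹, fun i => -w.color (w.perm⁻¹ i)⟩
  mul_assoc u v w := ColoredPerm.ext (mul_assoc _ _ _) (funext fun _ => (add_assoc _ _ _).symm)
  one_mul w := ColoredPerm.ext (one_mul _) (funext fun _ => add_zero _)
  mul_one w := ColoredPerm.ext (mul_one _) (funext fun _ => zero_add _)
  inv_mul_cancel w := ColoredPerm.ext (inv_mul_cancel _) (funext fun i => by
    change w.color i + -w.color (w.perm⁻¹ (w.perm i)) = 0
    simp)

theorem act_mul [NeZero r] (w v : ColoredPerm n r) (a : Fin n × Fin r) :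
    (w * v).act a = w.act (v.act a) :=
  Prod.ext rfl (add_assoc _ _ _).symm

theorem act_one [NeZero r] (a : Fin n × Fin r) : (1 : ColoredPerm n r).act a = a :=
  Prod.ext rfl (add_zero _)

/-- `w` with all colors negated modulo `r`. -/
def bar [NeZero r] (w : ColoredPerm n r) : ColoredPerm n r := ⟨w.perm, fun i => -w.color i⟩

/-- Absolute involutions: the inverse of `bar w` is `w`. -/
def IsAbsInvolution [NeZero r] (w : ColoredPerm n r) : Prop := (w.bar)⁻¹ = w

/-- The colored integer `w(i)^{c_i}` at position `i` of the window. -/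
def window (w : ColoredPerm n r) (i : Fin n) : Fin n × Fin r := (w.perm i, w.color i)

/-- The color order
`1^{r-1} < ⋯ < n^{r-1} < ⋯ < 1^1 < ⋯ < n^1 < 1^0 < ⋯ < n^0`. -/
def ColorLT (a b : Fin n × Fin r) : Prop := b.2 < a.2 ∨ (a.2 = b.2 ∧ a.1 < b.1)

open Classical in
/-- The type `A` descent set: all `i` with `1 ≤ i ≤ n - 1` such that, counting positions
from `1`, the `i`-th entry is larger than the `(i+1)`-st one in the color order. -/
noncomputable def desSetStar (w : ColoredPerm n r) : Finset ℕ :=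
  (Finset.range n).filter fun i =>
    ∃ (h : i < n) (_ : 1 ≤ i), ColorLT (w.window ⟨i, h⟩) (w.window ⟨i - 1, by omega⟩)

/-- The first color `c_1` as an integer in `[0, r - 1]` (and `0` for `n = 0`). -/
def firstColor (w : ColoredPerm n r) : ℕ :=
  if h : 0 < n then (w.color ⟨0, h⟩ : ℕ) else 0

/-- The descent set: `desSetStar`, together with `0` if `c_1 ≠ 0`. -/
noncomputable def desSet (w : ColoredPerm n r) : Finset ℕ :=
  if w.firstColor = 0 then w.desSetStar else insert 0 w.desSetStar

/-- The number of descents. -/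
noncomputable def des (w : ColoredPerm n r) : ℕ := w.desSet.card

/-- The major index. -/
noncomputable def maj (w : ColoredPerm n r) : ℕ := ∑ i ∈ w.desSet, i

/-- The sum of the colors, as integers in `[0, r - 1]`. -/
def csum (w : ColoredPerm n r) : ℕ := ∑ i, (w.color i : ℕ)

/-- The flag major index. -/
noncomputable def fmaj (w : ColoredPerm n r) : ℕ := r * w.maj + w.csum

/-- The flag descent number. -/
noncomputable def fdes (w : ColoredPerm n r) : ℕ := r * w.desSetStar.card + w.firstColor

/-- The number of fixed points of color `j`. -/
def fixCount (w : ColoredPerm n r) (j : Fin r) : ℕ :=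
  (Finset.univ.filter fun i : Fin n => w.perm i = i ∧ w.color i = j).card

end ColoredPerm

open Classical in
/-- `I_n(x, q, p_0, …, p_{r-1})`: sum over absolute involutions, tracking `des`, `fmaj` and the
numbers of fixed points of each color. -/
noncomputable def absInvPoly {A : Type*} [CommRing A] (n r : ℕ) [NeZero r] (x q : A)
    (p : Fin r → A) : A :=
  ∑ w : ColoredPerm n r with w.IsAbsInvolution,
    x ^ w.des * q ^ w.fmaj * ∏ j, p j ^ w.fixCount j

open Classical in
/-- The flag version, with `fdes` in place of `des`. -/
noncomputable def absInvPolyFlag {A : Type*} [CommRing A] (n r : ℕ) [NeZero r] (x q : A)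
    (p : Fin r → A) : A :=
  ∑ w : ColoredPerm n r with w.IsAbsInvolution,
    x ^ w.fdes * q ^ w.fmaj * ∏ j, p j ^ w.fixCount j

/-- `(a; q)_n = (1 - a)(1 - a q) ⋯ (1 - a q^{n-1})`. -/
def qPoch {A : Type*} [CommRing A] (a q : A) (n : ℕ) : A :=
  ∏ k ∈ Finset.range n, (1 - a * q ^ k)

/-- `∏_{0 ≤ i < j < N} (1 - z² q^{r(i+j) + 2c})`. -/
def pairProd {A : Type*} [CommRing A] (r c : ℕ) (z q : A) (N : ℕ) : A :=
  ∏ j ∈ Finset.range N, ∏ i ∈ Finset.range j, (1 - z ^ 2 * q ^ (r * (i + j) + 2 * c))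

/-- The multiplicative inverse of a formal power series with constant coefficient `1`. -/
noncomputable def recip {σ R : Type*} [CommRing R] (f : MvPowerSeries σ R) : MvPowerSeries σ R :=
  f.invOfUnit 1

/-- The indeterminates `x, q, z, p_0, …, p_{r-1}`. -/
inductive Var (r : ℕ) : Type
  | x : Var r
  | q : Var r
  | z : Var r
  | p (c : Fin r) : Var r

/-! Both identities evaluate a double series in x^m z^n in two ways. Its coefficient `labelledSum`
is a weighted count of pairs (π, F): F is a weakly decreasing word of labels in {0, …, M}, and π is
an involution of the n positions that increases on each block of equal labels and preserves labels
modulo r. The first identity takes M = rm, the second M = m.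

Sum over n: π is the stable sort of the swapped word of pairs (F i, F (π i)), so (π, F) is
determined by the multiset of these pairs, which can be any finite swap-symmetric multiset of pairs
of congruent labels. An entry (a, a) records a fixed point, and (a, b) together with (b, a) for a ≠
b a 2-cycle. The multiplicities are free, so independent geometric series give the product side
(`labelledInvolutionEquiv`, `hasSum_labelledSum`).

Sum over m: divide the labels by r. The remainders color π into an absolute involution w, and the
quotients form a weakly decreasing sequence that must drop at the descents of w
(`toLabelledInvolution_bijective`). The forced drops yield the descent number and major index; the
excess drops and the slack below the bound are free and yield the denominators
(`hasSum_absInvolution`). -/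

section PowerSeries

/-! ### Geometric series in monomials. -/

variable {σ R : Type*} [CommRing R]

theorem mul_recip {f : MvPowerSeries σ R} (hf : MvPowerSeries.constantCoeff f = 1) :
    f * recip f = 1 :=
  MvPowerSeries.mul_invOfUnit f 1 (by simpa using hf)

theorem recip_eq_of_mul_eq_one {f g : MvPowerSeries σ R}
    (hf : MvPowerSeries.constantCoeff f = 1) (h : f * g = 1) : recip f = g := by
  calc recip f = recip f * (f * g) := by rw [h, mul_one]
    _ = (f * recip f) * g := by ring
    _ = g := by rw [mul_recip hf, one_mul]

theorem recip_prod {ι : Type*} (s : Finset ι) (f : ι → MvPowerSeries σ R)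
    (hf : ∀ i ∈ s, MvPowerSeries.constantCoeff (f i) = 1) :
    recip (∏ i ∈ s, f i) = ∏ i ∈ s, recip (f i) := by
  apply recip_eq_of_mul_eq_one
  · rw [map_prod]
    exact Finset.prod_eq_one hf
  · rw [← Finset.prod_mul_distrib]
    exact Finset.prod_eq_one fun i hi => mul_recip (hf i hi)

/-- A monic monomial different from `1`. -/
def IsProperMonomial (u : MvPowerSeries σ R) : Prop :=
  ∃ d : σ →₀ ℕ, d ≠ 0 ∧ u = MvPowerSeries.monomial d 1

theorem IsProperMonomial.constantCoeff {u : MvPowerSeries σ R} (hu : IsProperMonomial u) :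
    MvPowerSeries.constantCoeff u = 0 := by
  classical
  obtain ⟨d, hd, rfl⟩ := hu
  rw [← MvPowerSeries.coeff_zero_eq_constantCoeff_apply, MvPowerSeries.coeff_monomial,
    if_neg hd.symm]

theorem IsProperMonomial.constantCoeff_one_sub {u : MvPowerSeries σ R}
    (hu : IsProperMonomial u) : MvPowerSeries.constantCoeff (1 - u) = 1 := by
  simp [hu.constantCoeff]

theorem isProperMonomial_X (s : σ) : IsProperMonomial (MvPowerSeries.X s : MvPowerSeries σ R) :=
  ⟨Finsupp.single s 1, by simp, rfl⟩

theorem IsProperMonomial.mul {u v : MvPowerSeries σ R} (hu : IsProperMonomial u)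
    (hv : IsProperMonomial v) : IsProperMonomial (u * v) := by
  obtain ⟨d, hd, rfl⟩ := hu
  obtain ⟨d', -, rfl⟩ := hv
  refine ⟨d + d', fun h => hd ?_, by rw [MvPowerSeries.monomial_mul_monomial, one_mul]⟩
  ext s
  have := DFunLike.congr_fun h s
  simp only [Finsupp.coe_add, Pi.add_apply, Finsupp.coe_zero, Pi.zero_apply] at this ⊢
  omega

theorem IsProperMonomial.pow {u : MvPowerSeries σ R} (hu : IsProperMonomial u) {k : ℕ}
    (hk : k ≠ 0) : IsProperMonomial (u ^ k) := by
  induction k with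
  | zero => exact absurd rfl hk
  | succ k ih =>
    rcases Nat.eq_zero_or_pos k with rfl | h
    · simpa using hu
    · rw [pow_succ]
      exact (ih h.ne').mul hu

theorem IsProperMonomial.mul_pow {u v : MvPowerSeries σ R} (hu : IsProperMonomial u)
    (hv : IsProperMonomial v) (k : ℕ) : IsProperMonomial (u * v ^ k) := by
  rcases Nat.eq_zero_or_pos k with rfl | h
  · simpa using hu
  · exact hu.mul (hv.pow h.ne')

variable [TopologicalSpace R]

theorem MvPowerSeries.summable_of_finite_coeff_ne_zero {ι : Type*} {f : ι → MvPowerSeries σ R}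
    (h : ∀ d, {i | MvPowerSeries.coeff d (f i) ≠ 0}.Finite) : Summable f := by
  rw [MvPowerSeries.WithPiTopology.summable_iff_summable_coeff]
  exact fun d => summable_of_hasFiniteSupport (h d)

/-- Each `u i` has degree at least 1, so only exponents bounded by the degree of `D` can contribute
to the coefficient at `D`. -/
theorem summable_prod_pow {ι : Type*} [Fintype ι] {u : ι → MvPowerSeries σ R}
    (hu : ∀ i, IsProperMonomial (u i)) : Summable fun e : ι → ℕ => ∏ i, u i ^ e i := by
  classical
  choose d hd hud using hu
  apply MvPowerSeries.summable_of_finite_coeff_ne_zero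
  intro D
  refine (Set.finite_Iic (fun _ : ι => D.degree)).subset fun e he i => ?_
  have hmon : ∏ i, u i ^ e i = MvPowerSeries.monomial (∑ i, e i • d i) (1 : R) := by
    rw [Finset.prod_congr rfl fun i _ => by rw [hud i, MvPowerSeries.monomial_pow, one_pow],
      MvPowerSeries.prod_monomial, Finset.prod_const_one]
  rw [Set.mem_ofPred_eq, hmon, MvPowerSeries.coeff_monomial] at he
  have hD : D = ∑ i, e i • d i := by
    by_contra h
    exact he (if_neg h)
  rw [hD, map_sum]
  have hdeg : 1 ≤ (d i).degree := Nat.one_le_iff_ne_zero.2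
    ((Finsupp.degree_eq_zero_iff _).not.2 (hd i))
  calc e i ≤ (e i • d i).degree := by
        rw [map_nsmul, smul_eq_mul]
        exact Nat.le_mul_of_pos_right _ hdeg
    _ ≤ _ := Finset.single_le_sum (f := fun i => (e i • d i).degree)
        (fun _ _ => Nat.zero_le _) (Finset.mem_univ i)

variable [DiscreteTopology R]

instance MvPowerSeries.t3Space_of_discrete : T3Space (MvPowerSeries σ R) :=
  inferInstanceAs (T3Space ((σ →₀ ℕ) → R))

theorem hasSum_pow_recip {u : MvPowerSeries σ R} (hu : IsProperMonomial u) :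
    HasSum (fun k : ℕ => u ^ k) (recip (1 - u)) := by
  have h0 := hu.constantCoeff
  have := (MvPowerSeries.WithPiTopology.summable_pow_of_constantCoeff_eq_zero h0).hasSum
  rwa [recip_eq_of_mul_eq_one hu.constantCoeff_one_sub
    (MvPowerSeries.WithPiTopology.one_sub_mul_tsum_pow_of_constantCoeff_eq_zero h0)]

theorem hasSum_fin_prod_pow_recip (n : ℕ) (u : Fin n → MvPowerSeries σ R)
    (hu : ∀ i, IsProperMonomial (u i)) :
    HasSum (fun e : Fin n → ℕ => ∏ i, u i ^ e i) (∏ i, recip (1 - u i)) := by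
  induction n with
  | zero => simp
  | succ n ih =>
    rw [Fin.prod_univ_succ]
    have hs := summable_prod_pow hu
    rw [← (Fin.consEquiv fun _ => ℕ).summable_iff] at hs
    rw [← (Fin.consEquiv fun _ => ℕ).hasSum_iff]
    have heq : (fun e : Fin (n + 1) → ℕ => ∏ i, u i ^ e i) ∘ (Fin.consEquiv fun _ => ℕ) =
        fun x : ℕ × (Fin n → ℕ) => u 0 ^ x.1 * ∏ i : Fin n, u i.succ ^ x.2 i := by
      funext x
      simp [Fin.prod_univ_succ, Fin.consEquiv]
    rw [heq] at hs ⊢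
    have h0 := hasSum_pow_recip (hu 0)
    have h1 := ih (fun i => u i.succ) fun i => hu i.succ
    exact HasSum.mul (f := fun k : ℕ => u 0 ^ k)
      (g := fun e : Fin n → ℕ => ∏ i : Fin n, u i.succ ^ e i) h0 h1 hs

theorem hasSum_prod_pow_recip {ι : Type*} [Fintype ι] (u : ι → MvPowerSeries σ R)
    (hu : ∀ i, IsProperMonomial (u i)) :
    HasSum (fun e : ι → ℕ => ∏ i, u i ^ e i) (∏ i, recip (1 - u i)) := by
  let f := Fintype.equivFin ι
  have h := hasSum_fin_prod_pow_recip _ (u ∘ f.symm) fun i => hu _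
  rw [← (f.arrowCongr (Equiv.refl ℕ)).hasSum_iff] at h
  convert h using 1
  · funext e
    simp only [Function.comp_apply, Equiv.arrowCongr_apply, Equiv.refl_apply]
    exact (f.symm.prod_comp fun i => u i ^ e i).symm
  · exact (f.symm.prod_comp fun i => recip (1 - u i)).symm

end PowerSeries

/-! ### Labelled involutions as swap-symmetric sorted words of pairs. -/

section LabelledInvolution

variable {L C : Type*} [LinearOrder L] {n : ℕ}

/-- A labelled involution of `Fin n`: the labels increase weakly, the involution increases on
each set of positions with a common label, and it preserves the colors `κ` of the labels. -/
structure IsLabelledInvolution (κ : L → C) (π : Equiv.Perm (Fin n)) (F : Fin n → L) : Prop where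
  invol : ∀ i, π (π i) = i
  color : ∀ i, κ (F (π i)) = κ (F i)
  lt : ∀ i j, i < j → F i < F j ∨ (F i = F j ∧ π i < π j)

namespace IsLabelledInvolution

variable {κ : L → C} {π : Equiv.Perm (Fin n)} {F : Fin n → L}

theorem monotone (h : IsLabelledInvolution κ π F) : Monotone F := by
  intro i j hij
  rcases hij.lt_or_eq with hij | rfl
  · rcases h.lt i j hij with h | h
    exacts [h.le, h.1.le]
  · exact le_rfl

/-- Two positions of a 2-cycle cannot share a label: π would increase on them, yet it exchanges
them. Hence fixed points are visible in the pairs of labels. -/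
theorem label_eq_iff (h : IsLabelledInvolution κ π F) (i : Fin n) : F i = F (π i) ↔ π i = i := by
  refine ⟨fun hF => ?_, fun hi => by rw [hi]⟩
  rcases lt_trichotomy i (π i) with hi | hi | hi
  · rcases h.lt _ _ hi with h' | h'
    · exact absurd hF h'.ne
    · rw [h.invol] at h'
      exact absurd h'.2 hi.not_gt
  · exact hi.symm
  · rcases h.lt _ _ hi with h' | h'
    · exact absurd hF.symm h'.ne
    · rw [h.invol] at h'
      exact absurd h'.2 hi.not_gt

end IsLabelledInvolution

/-- The word of pairs of labels at `i` and `π i`, with the lexicographic order on pairs. -/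
def labelPair (π : Equiv.Perm (Fin n)) (F : Fin n → L) (i : Fin n) : L ×ₗ L :=
  toLex (F i, F (π i))

/-- Interchange of the entries of a pair in lexicographic order. -/
def lexSwap {L : Type*} (x : L ×ₗ L) : L ×ₗ L := toLex (ofLex x).swap

theorem lexSwap_lexSwap {L : Type*} (x : L ×ₗ L) : lexSwap (lexSwap x) = x := rfl

namespace IsLabelledInvolution

variable {κ : L → C} {π : Equiv.Perm (Fin n)} {F : Fin n → L}

theorem lexSwap_labelPair (h : IsLabelledInvolution κ π F) :
    (lexSwap ∘ labelPair π F) ∘ π = labelPair π F := by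
  funext i
  simp [labelPair, lexSwap, h.invol]

theorem monotone_labelPair (h : IsLabelledInvolution κ π F) : Monotone (labelPair π F) := by
  intro i j hij
  rcases hij.lt_or_eq with hij | rfl
  · rw [labelPair, labelPair, Prod.Lex.toLex_le_toLex]
    rcases h.lt i j hij with h' | h'
    · exact Or.inl h'
    · exact Or.inr ⟨h'.1, h.monotone h'.2.le⟩
  · exact le_rfl

/-- Composing the swapped word with π returns the sorted word, and π increases on ties; these two
properties characterize the stable sort. So the word of pairs determines π. -/
theorem eq_sort (h : IsLabelledInvolution κ π F) :
    π = Tuple.sort (lexSwap ∘ labelPair π F) := by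
  rw [Tuple.eq_sort_iff, h.lexSwap_labelPair]
  refine ⟨h.monotone_labelPair, fun i j hij he => ?_⟩
  have h1 := congrFun h.lexSwap_labelPair i
  have h2 := congrFun h.lexSwap_labelPair j
  simp only [Function.comp_apply] at h1 h2 he
  rw [h1, h2] at he
  have hF : F i = F j := congrArg (fun x => (ofLex x).1) he
  rcases h.lt i j hij with h' | h'
  · exact absurd hF h'.ne
  · exact h'.2

end IsLabelledInvolution

/-- A sorted word of pairs that is stable under interchange comes from a labelled involution. -/
theorem exists_isLabelledInvolution {κ : L → C} {u : Fin n → L ×ₗ L} (hu : Monotone u)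
    (hκ : ∀ i, κ (ofLex (u i)).1 = κ (ofLex (u i)).2)
    (hsymm : ((List.ofFn u : List _) : Multiset (L ×ₗ L)) = List.ofFn (lexSwap ∘ u)) :
    ∃ (π : Equiv.Perm (Fin n)) (F : Fin n → L), IsLabelledInvolution κ π F ∧
      labelPair π F = u := by
  set σ := Tuple.sort (lexSwap ∘ u) with hσ
  obtain ⟨hmono, hties⟩ := Tuple.eq_sort_iff.1 hσ
  have hcomp : (lexSwap ∘ u) ∘ σ = u := by
    refine List.ofFn_injective (List.Perm.eq_of_sortedLE hmono.sortedLE_ofFn hu.sortedLE_ofFn ?_)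
    exact (Equiv.Perm.ofFn_comp_perm σ (lexSwap ∘ u)).trans (Multiset.coe_eq_coe.1 hsymm).symm
  have hval : ∀ i, lexSwap (u (σ i)) = u i := congrFun hcomp
  have hval' : ∀ i, u (σ i) = lexSwap (u i) := fun i => by rw [← hval i, lexSwap_lexSwap]
  -- The inverse also sorts the swapped word stably, so uniqueness of the stable sort makes `σ` an
  -- involution.
  have hinv : σ.symm = σ := by
    rw [hσ, ← hσ, Tuple.eq_sort_iff]
    have hval2 : ∀ i, lexSwap (u (σ.symm i)) = u i := fun i => by
      rw [← hval' (σ.symm i), Equiv.apply_symm_apply]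
    refine ⟨?_, fun i j hij he => ?_⟩
    · rw [show (lexSwap ∘ u) ∘ σ.symm = u from funext hval2]
      exact hu
    · simp only [Function.comp_apply] at he
      rcases lt_trichotomy (σ.symm i) (σ.symm j) with h | h | h
      · exact h
      · exact absurd (σ.symm.injective h) hij.ne
      · have := hties _ _ h (by
          simp only [Function.comp_apply, Equiv.apply_symm_apply]
          rw [← hval2 i, ← hval2 j, he])
        simp only [Equiv.apply_symm_apply] at this
        exact absurd this hij.not_gt
  have hinvol : ∀ i, σ (σ i) = i := fun i => by
    nth_rw 1 [← hinv]
    exact σ.symm_apply_apply i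
  have hpair : labelPair σ (fun i => (ofLex (u i)).1) = u := by
    funext i
    simp only [labelPair, hval', lexSwap]
    rfl
  refine ⟨σ, fun i => (ofLex (u i)).1, ⟨hinvol, fun i => ?_, fun i j hij => ?_⟩, hpair⟩
  · simp only [hval', lexSwap, ofLex_toLex, Prod.fst_swap]
    exact (hκ i).symm
  · have := hu hij.le
    rw [Prod.Lex.le_iff] at this
    rcases this with h | ⟨h, h'⟩
    · exact Or.inl h
    · refine or_iff_not_imp_left.2 fun _ => ⟨h, ?_⟩
      -- Second labels at `i`, `j` are first labels at `σ i`, `σ j`: if they differ, monotonicity of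
      -- `u` orders the images; if they agree, stability does.
      rcases h'.lt_or_eq with h' | h'
      · by_contra hle
        have := hu (not_lt.1 hle)
        rw [hval', hval', Prod.Lex.le_iff] at this
        rcases this with h3 | h3
        · exact absurd h3 h'.not_gt
        · exact absurd h3.1 h'.ne'
      · exact hties i j hij (by
          have : u i = u j := ofLex.injective (Prod.ext h h')
          simp only [Function.comp_apply, hval', this])

end LabelledInvolution

/-! ### Free multiplicities of increasing pairs. -/

section PairCount

variable {L C : Type*} [LinearOrder L] [DecidableEq C]

theorem count_ofFn {α : Type*} [DecidableEq α] {n : ℕ} (u : Fin n → α) (x : α) :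
    ((List.ofFn u : List α) : Multiset α).count x = (Finset.univ.filter fun i => u i = x).card := by
  rw [← Fin.univ_val_map, Multiset.count_map]
  simp only [eq_comm (a := x)]
  rfl

/-- Weakly increasing pairs of labels in `B` of the same color. -/
def increasingPairs (κ : L → C) (B : Finset L) : Finset (L × L) :=
  (B ×ˢ B).filter fun s => s.1 ≤ s.2 ∧ κ s.1 = κ s.2

/-- Labelled involutions of `Fin n` with labels in `B`. -/
abbrev LabelledInvolution (κ : L → C) (B : Finset L) (n : ℕ) : Type _ :=
  {t : Equiv.Perm (Fin n) × (Fin n → L) //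
    IsLabelledInvolution κ t.1 t.2 ∧ ∀ i, t.2 i ∈ B}

variable {κ : L → C} {B : Finset L}

/-- The number of positions at which a given pair of labels occurs. -/
def pairCount (t : Σ n, LabelledInvolution κ B n) (s : increasingPairs κ B) : ℕ :=
  (Finset.univ.filter fun i => labelPair t.2.1.1 t.2.1.2 i = toLex (s : L × L)).card

/-- The symmetric extension of a function of increasing pairs. -/
def symmExtend (e : increasingPairs κ B → ℕ) (x : L × L) : ℕ :=
  if h : x ∈ increasingPairs κ B then e ⟨x, h⟩
  else if h : x.swap ∈ increasingPairs κ B then e ⟨x.swap, h⟩ else 0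

theorem symmExtend_swap (e : increasingPairs κ B → ℕ) (x : L × L) :
    symmExtend e x.swap = symmExtend e x := by
  unfold symmExtend
  by_cases h1 : x ∈ increasingPairs κ B <;> by_cases h2 : x.swap ∈ increasingPairs κ B
  · have hx : x.swap = x := by
      simp only [increasingPairs, Finset.mem_filter, Prod.fst_swap, Prod.snd_swap] at h1 h2
      exact Prod.ext (le_antisymm h2.2.1 h1.2.1) (le_antisymm h1.2.1 h2.2.1)
    simp only [hx]
  all_goals simp [h1, h2]

theorem symmExtend_ne_zero {e : increasingPairs κ B → ℕ} {x : L × L} (h : symmExtend e x ≠ 0) :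
    x ∈ B ×ˢ B ∧ κ x.1 = κ x.2 := by
  unfold symmExtend at h
  split_ifs at h with h1 h2
  · simp only [increasingPairs, Finset.mem_filter] at h1
    exact ⟨h1.1, h1.2.2⟩
  · simp only [increasingPairs, Finset.mem_filter, Finset.mem_product, Prod.fst_swap,
      Prod.snd_swap] at h2
    exact ⟨Finset.mem_product.2 h2.1.symm, h2.2.2.symm⟩
  · exact absurd rfl h

/-- The involution matches positions carrying a pair with positions carrying its swap, so the counts
on increasing pairs determine all counts. -/
theorem count_labelPair (t : Σ n, LabelledInvolution κ B n) (x : L ×ₗ L) :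
    ((List.ofFn (labelPair t.2.1.1 t.2.1.2) : List _) : Multiset (L ×ₗ L)).count x =
      symmExtend (pairCount t) (ofLex x) := by
  obtain ⟨n, ⟨⟨π, F⟩, h, hB⟩⟩ := t
  have hswap : ∀ x : L ×ₗ L,
      ((List.ofFn (labelPair π F) : List _) : Multiset (L ×ₗ L)).count x =
      ((List.ofFn (labelPair π F) : List _) : Multiset (L ×ₗ L)).count (lexSwap x) := by
    intro x
    rw [count_ofFn, count_ofFn]
    refine Finset.card_bij (fun i _ => π i) ?_ (fun _ _ _ _ h => π.injective h) ?_
    · intro i hi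
      simp only [Finset.mem_filter, Finset.mem_univ, true_and] at hi ⊢
      rw [← hi]
      simp [labelPair, lexSwap, h.invol]
    · intro i hi
      simp only [Finset.mem_filter, Finset.mem_univ, true_and] at hi ⊢
      refine ⟨π i, ?_, h.invol i⟩
      rw [← lexSwap_lexSwap x, ← hi]
      simp [labelPair, lexSwap, h.invol]
  unfold symmExtend
  split_ifs with h1 h2
  · rw [count_ofFn]
    rfl
  · rw [hswap, count_ofFn]
    rfl
  · refine Multiset.count_eq_zero.2 fun hx => ?_
    obtain ⟨i, rfl⟩ := List.mem_ofFn.1 (Multiset.mem_coe.1 hx)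
    simp only [increasingPairs, Finset.mem_filter, Finset.mem_product, labelPair, ofLex_toLex,
      Prod.fst_swap, Prod.snd_swap, hB, true_and, h.color, and_true, not_le] at h1 h2
    exact absurd h1 h2.not_gt

theorem pairCount_injective :
    Function.Injective (pairCount : (Σ n, LabelledInvolution κ B n) → _) := by
  intro t t' htt
  have hlist : List.ofFn (labelPair t.2.1.1 t.2.1.2) = List.ofFn (labelPair t'.2.1.1 t'.2.1.2) := by
    refine List.Perm.eq_of_sortedLE t.2.2.1.monotone_labelPair.sortedLE_ofFn
      t'.2.2.1.monotone_labelPair.sortedLE_ofFn (Multiset.coe_eq_coe.1 (Multiset.ext.2 fun x => ?_))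
    rw [count_labelPair, count_labelPair, htt]
  obtain ⟨n, ⟨⟨π, F⟩, h, hB⟩⟩ := t
  obtain ⟨n', ⟨⟨π', F'⟩, h', hB'⟩⟩ := t'
  obtain rfl : n = n' := by simpa using congrArg List.length hlist
  have hu : labelPair π F = labelPair π' F' := List.ofFn_injective hlist
  obtain rfl : F = F' := funext fun i => congrArg (fun x => (ofLex x).1) (congrFun hu i)
  obtain rfl : π = π' := h.eq_sort.trans
    ((congrArg (fun u => Tuple.sort (lexSwap ∘ u)) hu).trans h'.eq_sort.symm)
  rfl

theorem pairCount_surjective :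
    Function.Surjective (pairCount : (Σ n, LabelledInvolution κ B n) → _) := by
  intro e
  let m : Multiset (L ×ₗ L) := Finsupp.toMultiset
    (Finsupp.onFinset ((B ×ˢ B).map toLex.toEmbedding) (fun x => symmExtend e (ofLex x)) (by
      intro x hx
      exact Finset.mem_map.2 ⟨ofLex x, (symmExtend_ne_zero hx).1, rfl⟩))
  have hcount : ∀ x, m.count x = symmExtend e (ofLex x) := fun x => Finsupp.count_toMultiset _ x
  let l := m.sort (· ≤ ·)
  have hl : (List.ofFn l.get : Multiset (L ×ₗ L)) = m := by
    rw [List.ofFn_get]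
    exact m.sort_eq _
  have hmem : ∀ i, symmExtend e (ofLex (l.get i)) ≠ 0 := fun i => by
    rw [← hcount, ← Nat.pos_iff_ne_zero, Multiset.count_pos, ← hl, Multiset.mem_coe, List.mem_ofFn]
    exact ⟨i, rfl⟩
  have hmono : Monotone l.get := by
    rw [← List.sortedLE_ofFn_iff, List.ofFn_get]
    exact (m.pairwise_sort (· ≤ ·)).sortedLE
  obtain ⟨π, F, h, hpair⟩ := exists_isLabelledInvolution (κ := κ) hmono
    (fun i => (symmExtend_ne_zero (hmem i)).2) (by
      rw [hl]
      refine Multiset.ext.2 fun x => ?_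
      have : (List.ofFn (lexSwap ∘ l.get) : Multiset (L ×ₗ L)) = m.map lexSwap := by
        rw [← hl, Multiset.map_coe, List.map_ofFn]
      rw [this, ← lexSwap_lexSwap x, Multiset.count_map_eq_count' _ _
        (Function.LeftInverse.injective lexSwap_lexSwap), hcount, hcount]
      exact symmExtend_swap e _)
  have hB : ∀ i, F i ∈ B := fun i => by
    have := (symmExtend_ne_zero (hmem i)).1
    rw [← hpair] at this
    exact (Finset.mem_product.1 this).1
  refine ⟨⟨_, ⟨(π, F), h, hB⟩⟩, funext fun s => ?_⟩
  simp only [pairCount, hpair]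
  rw [← count_ofFn, hl, hcount]
  simp [symmExtend]

/-- Labelled involutions correspond to multiplicities of increasing pairs. -/
noncomputable def labelledInvolutionEquiv (κ : L → C) (B : Finset L) :
    (Σ n, LabelledInvolution κ B n) ≃ (increasingPairs κ B → ℕ) :=
  Equiv.ofBijective pairCount ⟨pairCount_injective, pairCount_surjective⟩

/-- The two factors of a 2-cycle are collected at its position with the smaller label, while a fixed
point keeps its single factor. -/
theorem prod_pow_pairCount {A : Type*} [CommMonoid A] (g : L → L → A)
    (t : Σ n, LabelledInvolution κ B n) :
    ∏ s : increasingPairs κ B,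
      (if s.1.1 = s.1.2 then g s.1.1 s.1.1 else g s.1.1 s.1.2 * g s.1.2 s.1.1) ^ pairCount t s =
      ∏ i, g (t.2.1.2 i) (t.2.1.2 (t.2.1.1 i)) := by
  obtain ⟨n, ⟨⟨π, F⟩, h, hB⟩⟩ := t
  set φ : L × L → A := fun s => if s.1 = s.2 then g s.1 s.1 else g s.1 s.2 * g s.2 s.1 with hφ
  have h1 : ∏ i, g (F i) (F (π i)) =
      ∏ i ∈ Finset.univ.filter (fun i => F i ≤ F (π i)), φ (F i, F (π i)) := by
    rw [← Finset.prod_filter_mul_prod_filter_not Finset.univ (fun i => F i ≤ F (π i))]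
    -- Reindexing by π reaches only strictly increasing pairs; the factor 1 accounts for the
    -- diagonal.
    have h2 : ∏ i ∈ Finset.univ.filter (fun i => ¬ F i ≤ F (π i)), g (F i) (F (π i)) =
        ∏ i ∈ Finset.univ.filter (fun i => F i ≤ F (π i)),
          if F i = F (π i) then 1 else g (F (π i)) (F i) := by
      rw [Finset.prod_ite, Finset.prod_const_one, one_mul, Finset.filter_filter]
      refine Finset.prod_bij (fun i _ => π i) ?_ (fun _ _ _ _ h => π.injective h) ?_ ?_
      · intro i hi
        simp only [Finset.mem_filter, Finset.mem_univ, true_and, not_le, h.invol] at hi ⊢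
        exact ⟨hi.le, hi.ne⟩
      · intro i hi
        simp only [Finset.mem_filter, Finset.mem_univ, true_and] at hi
        refine ⟨π i, ?_, h.invol i⟩
        simp only [Finset.mem_filter, Finset.mem_univ, true_and, not_le, h.invol]
        exact lt_of_le_of_ne hi.1 hi.2
      · intro i _
        rw [h.invol]
    rw [h2, ← Finset.prod_mul_distrib]
    refine Finset.prod_congr rfl fun i _ => ?_
    simp only [hφ]
    split_ifs with hF
    · rw [mul_one, ← hF]
    · rfl
  change _ = ∏ i, g (F i) (F (π i))
  rw [h1]
  have hmaps : ∀ i ∈ Finset.univ.filter (fun i => F i ≤ F (π i)),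
      (F i, F (π i)) ∈ increasingPairs κ B := by
    intro i hi
    simp only [Finset.mem_filter, Finset.mem_univ, true_and] at hi
    simp [increasingPairs, hB, hi, h.color]
  rw [← Finset.prod_fiberwise_of_maps_to hmaps fun i => φ (F i, F (π i)),
    ← Finset.prod_coe_sort (increasingPairs κ B)]
  refine Finset.prod_congr rfl fun s _ => ?_
  refine Eq.symm ((Finset.prod_congr rfl (g := fun _ => φ s)
    fun i hi => by rw [(Finset.mem_filter.1 hi).2]).trans ?_)
  rw [Finset.prod_const]
  refine congrArg (φ s ^ ·) (congrArg Finset.card (Finset.ext fun i => ?_))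
  have hs := (Finset.mem_filter.1 s.2).2.1
  simp only [Finset.filter_filter]
  rw [Finset.mem_filter_univ, Finset.mem_filter_univ]
  refine ⟨fun hi => congrArg toLex hi.2, fun hi => ?_⟩
  have hi' : (F i, F (π i)) = (s : L × L) := toLex.injective hi
  refine ⟨?_, hi'⟩
  rw [← hi'] at hs
  exact hs

end PairCount

/-! ### Natural labels and the product side. -/

section NaturalLabels

/-- Colors of natural number labels: residues modulo `r`. Labels are listed in decreasing order. -/
def residue (r : ℕ) (a : ℕᵒᵈ) : ℕ := OrderDual.ofDual a % r

/-- The labels `0, …, M`. -/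
def labelsUpTo (M : ℕ) : Finset ℕᵒᵈ := (Finset.range (M + 1)).map OrderDual.toDual.toEmbedding

theorem mem_labelsUpTo {M : ℕ} {a : ℕᵒᵈ} : a ∈ labelsUpTo M ↔ OrderDual.ofDual a ≤ M := by
  simp only [labelsUpTo, Finset.mem_map, Finset.mem_range, Equiv.coe_toEmbedding]
  constructor
  · rintro ⟨b, hb, rfl⟩
    exact Nat.lt_succ_iff.1 hb
  · exact fun h => ⟨OrderDual.ofDual a, Nat.lt_succ_iff.2 h, rfl⟩

instance {L C : Type*} [LinearOrder L] [DecidableEq C] (κ : L → C) (B : Finset L) (n : ℕ) :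
    Finite (LabelledInvolution κ B n) := by
  refine Finite.of_injective
    (β := Equiv.Perm (Fin n) × (Fin n → B)) (fun t => (t.1.1, fun i => ⟨t.1.2 i, t.2.2 i⟩)) ?_
  intro t t' h
  simp only [Prod.mk.injEq, funext_iff, Subtype.mk.injEq] at h
  exact Subtype.ext (Prod.ext h.1 (funext h.2))

noncomputable instance {L C : Type*} [LinearOrder L] [DecidableEq C] (κ : L → C) (B : Finset L)
    (n : ℕ) : Fintype (LabelledInvolution κ B n) := Fintype.ofFinite _

/-- The generating function of labelled involutions of `Fin n` with labels at most `M`, by the sum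
of the labels and the colors of the fixed points. -/
noncomputable def labelledSum {A : Type*} [CommRing A] (n r M : ℕ) [NeZero r] (q : A)
    (p : Fin r → A) : A :=
  ∑ t : LabelledInvolution (residue r) (labelsUpTo M) n,
    ∏ i, q ^ OrderDual.ofDual (t.1.2 i) *
      if t.1.1 i = i then p (Fin.ofNat r (OrderDual.ofDual (t.1.2 i))) else 1

/-- The new bound is ⌈(N - c)/r⌉, the number of b < N with residue c, written so that no subtraction
truncates. -/
theorem prod_range_residue {A : Type*} [CommMonoid A] {r c : ℕ} (hc : c < r) (N : ℕ) (χ : ℕ → A) :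
    ∏ b ∈ (Finset.range N).filter (fun b => b % r = c), χ b =
      ∏ i ∈ Finset.range ((N + r - 1 - c) / r), χ (r * i + c) := by
  have hr : 0 < r := by omega
  refine (Finset.prod_bij (fun i _ => r * i + c) ?_ ?_ ?_ fun _ _ => rfl).symm
  · intro i hi
    rw [Finset.mem_range, Nat.lt_iff_add_one_le, Nat.le_div_iff_mul_le hr, add_mul, one_mul,
      mul_comm i r] at hi
    simp only [Finset.mem_filter, Finset.mem_range, Nat.mul_add_mod, Nat.mod_eq_of_lt hc, and_true]
    omega
  · intro i _ j _ h
    exact Nat.eq_of_mul_eq_mul_left hr (Nat.add_right_cancel h)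
  · intro b hb
    simp only [Finset.mem_filter, Finset.mem_range] at hb
    have hdiv := Nat.div_add_mod b r
    refine ⟨b / r, ?_, by omega⟩
    rw [Finset.mem_range, Nat.lt_iff_add_one_le, Nat.le_div_iff_mul_le hr, add_mul, one_mul,
      mul_comm _ r]
    omega

theorem prod_range_eq_prod_residues {A : Type*} [CommMonoid A] (r : ℕ) [NeZero r] (N : ℕ)
    (χ : ℕ → A) :
    ∏ b ∈ Finset.range N, χ b =
      ∏ c : Fin r, ∏ i ∈ Finset.range ((N + r - 1 - c) / r), χ (r * i + c) := by
  rw [← Finset.prod_fiberwise _ (fun b => Fin.ofNat r b)]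
  refine Finset.prod_congr rfl fun c _ => ?_
  rw [← prod_range_residue c.2]
  refine Finset.prod_congr (Finset.filter_congr fun b _ => ?_) fun _ _ => rfl
  rw [Fin.ext_iff]
  rfl

theorem prod_increasingPairs {A : Type*} [CommMonoid A] (r : ℕ) [NeZero r] (M : ℕ)
    (ψ : ℕ → ℕ → A) :
    ∏ s ∈ increasingPairs (residue r) (labelsUpTo M),
      ψ (OrderDual.ofDual s.1) (OrderDual.ofDual s.2) =
      ∏ c : Fin r, ((∏ k ∈ Finset.range ((M + r - c) / r), ψ (r * k + c) (r * k + c)) *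
        ∏ j ∈ Finset.range ((M + r - c) / r), ∏ i ∈ Finset.range j,
          ψ (r * j + c) (r * i + c)) := by
  have h1 : ∏ s ∈ increasingPairs (residue r) (labelsUpTo M),
      ψ (OrderDual.ofDual s.1) (OrderDual.ofDual s.2) =
      ∏ a ∈ Finset.range (M + 1),
        ∏ b ∈ (Finset.range (a + 1)).filter (fun b => b % r = a % r), ψ a b := by
    rw [Finset.prod_sigma']
    refine Finset.prod_bij' (fun s _ => ⟨OrderDual.ofDual s.1, OrderDual.ofDual s.2⟩)
      (fun s _ => (OrderDual.toDual s.1, OrderDual.toDual s.2)) ?_ ?_ (fun _ _ => rfl)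
      (fun _ _ => rfl) (fun _ _ => rfl)
    · intro s hs
      simp only [increasingPairs, Finset.mem_filter, Finset.mem_product, mem_labelsUpTo] at hs
      simp only [Finset.mem_sigma, Finset.mem_filter, Finset.mem_range]
      exact ⟨Nat.lt_succ_of_le hs.1.1, Nat.lt_succ_of_le hs.2.1, hs.2.2.symm⟩
    · intro s hs
      simp only [Finset.mem_sigma, Finset.mem_filter, Finset.mem_range] at hs
      simp only [increasingPairs, Finset.mem_filter, Finset.mem_product, mem_labelsUpTo]
      exact ⟨⟨Nat.le_of_lt_succ hs.1, (Nat.le_of_lt_succ hs.2.1).trans (Nat.le_of_lt_succ hs.1)⟩,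
        Nat.le_of_lt_succ hs.2.1, hs.2.2.symm⟩
  rw [h1, prod_range_eq_prod_residues r]
  refine Finset.prod_congr rfl fun c _ => ?_
  rw [← Finset.prod_mul_distrib]
  have hr : 0 < r := NeZero.pos r
  refine Finset.prod_congr (by congr 2; omega) fun k _ => ?_
  rw [Nat.mul_add_mod, Nat.mod_eq_of_lt c.2, prod_range_residue c.2,
    show r * k + ↑c + 1 + r - 1 - ↑c = r * (k + 1) by rw [mul_add]; omega,
    Nat.mul_div_cancel_left _ hr, Finset.prod_range_succ, mul_comm]

variable {σ R : Type*} [CommRing R] {r : ℕ} [NeZero r] {q z : MvPowerSeries σ R}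
  {p : Fin r → MvPowerSeries σ R}

theorem prod_increasingPairs_recip (hq : IsProperMonomial q) (hz : IsProperMonomial z)
    (hp : ∀ c, IsProperMonomial (p c)) (M : ℕ) :
    ∏ s : increasingPairs (residue r) (labelsUpTo M), recip (1 - if s.1.1 = s.1.2 then
        z * q ^ OrderDual.ofDual s.1.1 * p (Fin.ofNat r (OrderDual.ofDual s.1.1))
        else z * q ^ OrderDual.ofDual s.1.1 * (z * q ^ OrderDual.ofDual s.1.2)) =
      ∏ c : Fin r, recip (qPoch (p c * q ^ (c : ℕ) * z) (q ^ r) ((M + r - c) / r)) *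
        recip (pairProd r c z q ((M + r - c) / r)) := by
  rw [Finset.prod_coe_sort (increasingPairs (residue r) (labelsUpTo M))
    (fun s => recip (1 - if s.1 = s.2 then
      z * q ^ OrderDual.ofDual s.1 * p (Fin.ofNat r (OrderDual.ofDual s.1))
      else z * q ^ OrderDual.ofDual s.1 * (z * q ^ OrderDual.ofDual s.2)))]
  refine (prod_increasingPairs r M (fun a b => recip (1 - if a = b then
      z * q ^ a * p (Fin.ofNat r a) else z * q ^ a * (z * q ^ b)))).trans ?_
  refine Finset.prod_congr rfl fun c _ => ?_
  have hr : r ≠ 0 := NeZero.ne r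
  have hmono : ∀ (c : Fin r) (k : ℕ), IsProperMonomial (p c * q ^ (c : ℕ) * z * (q ^ r) ^ k) :=
    fun c k => ((((hp c).mul_pow hq c).mul hz).mul_pow (hq.pow hr) k)
  have hmono2 : ∀ k : ℕ, IsProperMonomial (z ^ 2 * q ^ k) :=
    fun k => (hz.pow two_ne_zero).mul_pow hq k
  rw [qPoch, recip_prod _ _ fun k _ => (hmono c k).constantCoeff_one_sub, pairProd,
    recip_prod _ _ fun j _ => by
      rw [map_prod]
      exact Finset.prod_eq_one fun i _ => (hmono2 _).constantCoeff_one_sub]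
  congr 1
  · refine Finset.prod_congr rfl fun k _ => ?_
    have : Fin.ofNat r (r * k + c) = c := Fin.ext (by
      simp [Fin.ofNat, Nat.mod_eq_of_lt c.2])
    rw [if_pos rfl, this, pow_add, pow_mul]
    congr 2
    ring
  · refine Finset.prod_congr rfl fun j _ => ?_
    rw [recip_prod _ _ fun i _ => (hmono2 _).constantCoeff_one_sub]
    refine Finset.prod_congr rfl fun i hi => ?_
    rw [if_neg fun h => ?_]
    · congr 2
      rw [mul_add]
      ring
    · have := Nat.eq_of_mul_eq_mul_left (NeZero.pos r) (Nat.add_right_cancel h)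
      exact (Finset.mem_range.1 hi).ne' this

variable [TopologicalSpace R] [DiscreteTopology R]

/-- Expand every factor as a geometric series, read the exponents as multiplicities of pairs, and
group the resulting labelled involutions by n. -/
theorem hasSum_labelledSum (hq : IsProperMonomial q) (hz : IsProperMonomial z)
    (hp : ∀ c, IsProperMonomial (p c)) (M : ℕ) :
    HasSum (fun n => z ^ n * labelledSum n r M q p)
      (∏ c : Fin r, recip (qPoch (p c * q ^ (c : ℕ) * z) (q ^ r) ((M + r - c) / r)) *
        recip (pairProd r c z q ((M + r - c) / r))) := by
  rw [← prod_increasingPairs_recip hq hz hp]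
  have hzq : ∀ k : ℕ, IsProperMonomial (z * q ^ k) := fun k => hz.mul_pow hq k
  have h := hasSum_prod_pow_recip (fun s : increasingPairs (residue r) (labelsUpTo M) =>
    if s.1.1 = s.1.2 then z * q ^ OrderDual.ofDual s.1.1 * p (Fin.ofNat r (OrderDual.ofDual s.1.1))
    else z * q ^ OrderDual.ofDual s.1.1 * (z * q ^ OrderDual.ofDual s.1.2)) (fun s => by
      split_ifs
      exacts [(hzq _).mul (hp _), (hzq _).mul (hzq _)])
  rw [← (labelledInvolutionEquiv (residue r) (labelsUpTo M)).hasSum_iff] at h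
  refine h.sigma fun n => ?_
  rw [labelledSum, Finset.mul_sum]
  convert hasSum_fintype _ using 1
  refine Finset.sum_congr rfl fun t _ => ?_
  have hw := prod_pow_pairCount (fun a b : ℕᵒᵈ => z * q ^ OrderDual.ofDual a *
    if a = b then p (Fin.ofNat r (OrderDual.ofDual a)) else 1) ⟨n, t⟩
  have hconst : z ^ n = ∏ _i : Fin n, z := by simp
  rw [hconst, ← Finset.prod_mul_distrib]
  refine Eq.trans ?_ (hw.symm.trans ?_)
  · refine Finset.prod_congr rfl fun i _ => ?_
    dsimp only
    rw [← mul_assoc]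
    simp only [t.2.1.label_eq_iff i]
  · refine Finset.prod_congr rfl fun s _ => ?_
    congr 1
    by_cases hs : s.1.1 = s.1.2
    · simp [hs]
    · simp [hs, Ne.symm hs]

end NaturalLabels

/-! ### Decreasing sequences with prescribed least gaps. -/

section GapFunctions

variable {n : ℕ}

/-- The value at the next position, and `0` at the last position. -/
def nextValue (f : Fin n → ℕ) (i : Fin n) : ℕ := if h : (i : ℕ) + 1 < n then f ⟨i + 1, h⟩ else 0

/-- The value at the first position, and `0` for `n = 0`. -/
def firstValue (f : Fin n → ℕ) : ℕ := if h : 0 < n then f ⟨0, h⟩ else 0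

/-- The sums of the values from a position on. -/
def suffixSum (g : Fin n → ℕ) (i : Fin n) : ℕ := ∑ k, if i ≤ k then g k else 0

theorem suffixSum_eq (g : Fin n → ℕ) (i : Fin n) :
    suffixSum g i = g i + nextValue (suffixSum g) i := by
  have hsplit : suffixSum g i = g i + ∑ k, if i < k then g k else 0 := by
    rw [suffixSum, ← Finset.sum_ite_eq' Finset.univ i g |>.trans (if_pos (Finset.mem_univ i)),
      ← Finset.sum_add_distrib]
    refine Finset.sum_congr rfl fun k _ => ?_
    rcases lt_trichotomy i k with h | h | h
    · simp [h, h.le, h.ne']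
    · simp [h]
    · simp [h.not_ge, h.not_gt, h.ne]
  rw [hsplit, nextValue]
  congr 1
  split_ifs with h
  · rfl
  · refine Finset.sum_eq_zero fun k _ => if_neg fun hk => h ?_
    have := k.2
    rw [Fin.lt_def] at hk
    omega

theorem eq_of_gaps_eq {f f' g : Fin n → ℕ} (hf : ∀ i, f i = g i + nextValue f i)
    (hf' : ∀ i, f' i = g i + nextValue f' i) : f = f' := by
  -- Induction from the last position, where the next value is 0 by convention.
  have key : ∀ d : ℕ, ∀ i : Fin n, n - i = d → f i = f' i := by
    intro d
    induction d with
    | zero => exact fun i hi => absurd i.2 (by omega)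
    | succ d ih =>
      intro i hi
      rw [hf, hf']
      simp only [nextValue]
      split_ifs with h
      · rw [ih ⟨i + 1, h⟩ (by simp only; omega)]
      · rfl
  exact funext fun i => key _ i rfl

theorem firstValue_suffixSum (g : Fin n → ℕ) : firstValue (suffixSum g) = ∑ k, g k := by
  rw [firstValue]
  split_ifs with h
  · exact Finset.sum_congr rfl fun k _ => if_pos (Fin.le_def.2 (Nat.zero_le _))
  · obtain rfl : n = 0 := by omega
    simp

theorem sum_suffixSum (g : Fin n → ℕ) : ∑ i, suffixSum g i = ∑ k : Fin n, (k + 1) * g k := by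
  simp only [suffixSum]
  rw [Finset.sum_comm]
  refine Finset.sum_congr rfl fun k _ => ?_
  rw [← Finset.sum_filter, Finset.sum_const, smul_eq_mul]
  congr 1
  rw [← Fin.card_Iic k]
  congr 1
  ext a
  simp

/-- Functions that decrease at position `i` by at least `δ i`. -/
abbrev GapFunction (δ : Fin n → ℕ) : Type := {f : Fin n → ℕ // ∀ i, nextValue f i + δ i ≤ f i}

/-- Functions with prescribed least gaps are determined by their arbitrary excess gaps. -/
def gapEquiv (δ : Fin n → ℕ) : (Fin n → ℕ) ≃ GapFunction δ where
  toFun e := ⟨suffixSum (e + δ), fun i => by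
    rw [suffixSum_eq (e + δ) i, Pi.add_apply]
    omega⟩
  invFun f i := f.1 i - nextValue f.1 i - δ i
  left_inv e := by
    funext i
    have := suffixSum_eq (e + δ) i
    rw [Pi.add_apply] at this
    dsimp only
    omega
  right_inv f := by
    refine Subtype.ext (eq_of_gaps_eq (suffixSum_eq _) fun i => ?_)
    have := f.2 i
    simp only [Pi.add_apply]
    omega

variable {σ R : Type*} [CommRing R] [TopologicalSpace R] [DiscreteTopology R]
  {x Q : MvPowerSeries σ R}

/-- A unit of gap after position `i` raises the first `i + 1` values by 1, hence contributes `x ^ s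
* Q ^ (i + 1)`. Excess gaps are free, `δ` gives the prefactor, and the free slack `a.1` gives 1/(1 -
x). -/
theorem hasSum_gapFunction (hx : IsProperMonomial x) (hQ : IsProperMonomial Q) {s : ℕ}
    (hs : s ≠ 0) (h : ℕ) (δ : Fin n → ℕ) :
    HasSum (fun a : ℕ × GapFunction δ =>
        x ^ (a.1 + (s * firstValue a.2.1 + h)) * Q ^ ∑ i, a.2.1 i)
      (x ^ h * (∏ i : Fin n, (x ^ s * Q ^ ((i : ℕ) + 1)) ^ δ i) *
        (recip (1 - x) * ∏ i : Fin n, recip (1 - x ^ s * Q ^ ((i : ℕ) + 1)))) := by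
  have hu : ∀ i, IsProperMonomial
      ((Fin.cons x fun i : Fin n => x ^ s * Q ^ ((i : ℕ) + 1) : Fin (n + 1) → _) i) := by
    intro i
    refine Fin.cases ?_ (fun i => ?_) i
    · simpa using hx
    · simpa using (hx.pow hs).mul (hQ.pow (Nat.succ_ne_zero i))
  have H := hasSum_fin_prod_pow_recip (n + 1) _ hu
  rw [Fin.prod_univ_succ] at H
  simp only [Fin.cons_zero, Fin.cons_succ] at H
  rw [← (Fin.consEquiv fun _ => ℕ).hasSum_iff] at H
  rw [← ((Equiv.refl ℕ).prodCongr (gapEquiv δ)).hasSum_iff]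
  refine (H.mul_left _).congr_fun fun a => ?_
  obtain ⟨k, e⟩ := a
  have hprod : ∏ i : Fin n, (x ^ s * Q ^ ((i : ℕ) + 1)) ^ (e + δ) i =
      x ^ (s * firstValue (suffixSum (e + δ))) * Q ^ ∑ i, suffixSum (e + δ) i := by
    rw [firstValue_suffixSum, sum_suffixSum, Finset.mul_sum, ← Finset.prod_pow_eq_pow_sum,
      ← Finset.prod_pow_eq_pow_sum, ← Finset.prod_mul_distrib]
    exact Finset.prod_congr rfl fun i _ => by rw [mul_pow, ← pow_mul, ← pow_mul]
  have hsplit : ∏ i : Fin n, (x ^ s * Q ^ ((i : ℕ) + 1)) ^ (e + δ) i =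
      (∏ i : Fin n, (x ^ s * Q ^ ((i : ℕ) + 1)) ^ e i) *
        ∏ i : Fin n, (x ^ s * Q ^ ((i : ℕ) + 1)) ^ δ i := by
    rw [← Finset.prod_mul_distrib]
    exact Finset.prod_congr rfl fun i _ => by rw [Pi.add_apply, pow_add]
  have hcons : ∏ i, (Fin.cons x fun i : Fin n => x ^ s * Q ^ ((i : ℕ) + 1) : Fin (n + 1) → _) i ^
      (Fin.consEquiv fun _ => ℕ) (k, e) i =
        x ^ k * ∏ i : Fin n, (x ^ s * Q ^ ((i : ℕ) + 1)) ^ e i := by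
    rw [Fin.prod_univ_succ]
    simp [Fin.consEquiv]
  change x ^ (k + (s * firstValue (suffixSum (e + δ)) + h)) * Q ^ ∑ i, suffixSum (e + δ) i =
    _ * ∏ i, _ ^ (Fin.consEquiv fun _ => ℕ) (k, e) i
  rw [hcons, pow_add, pow_add]
  linear_combination x ^ k * x ^ h * (hsplit - hprod)

/-- Grouping by the exponent of `x`. -/
theorem hasSum_boundedGapFunction (hx : IsProperMonomial x) (hQ : IsProperMonomial Q) {s : ℕ}
    (hs : s ≠ 0) (h : ℕ) (δ : Fin n → ℕ) (P : ℕ → GapFunction δ → Prop)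
    [∀ m, Fintype {f // P m f}] (hP : ∀ m f, P m f ↔ s * firstValue f.1 + h ≤ m) :
    HasSum (fun m => x ^ m * ∑ f : {f // P m f}, Q ^ ∑ i, f.1.1 i)
      (x ^ h * (∏ i : Fin n, (x ^ s * Q ^ ((i : ℕ) + 1)) ^ δ i) *
        (recip (1 - x) * ∏ i : Fin n, recip (1 - x ^ s * Q ^ ((i : ℕ) + 1)))) := by
  -- Replace the bound `m` by its slack over the least admissible bound.
  let E : (Σ m, {f // P m f}) ≃ ℕ × GapFunction δ :=
    { toFun := fun a => (a.1 - (s * firstValue a.2.1.1 + h), a.2.1)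
      invFun := fun a => ⟨a.1 + (s * firstValue a.2.1 + h), a.2, (hP _ _).2 (Nat.le_add_left _ _)⟩
      left_inv := fun ⟨m, f, hf⟩ => by
        have := Nat.sub_add_cancel ((hP _ _).1 hf)
        refine Sigma.ext this ?_
        refine (Subtype.heq_iff_coe_eq fun g => ?_).2 rfl
        dsimp only
        rw [this]
      right_inv := fun a => Prod.ext (Nat.add_sub_cancel _ _) rfl }
  have H := hasSum_gapFunction hx hQ hs h δ
  rw [← E.hasSum_iff] at H
  refine H.sigma fun m => ?_
  rw [Finset.mul_sum]
  convert hasSum_fintype _ using 1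
  refine Finset.sum_congr rfl fun f _ => ?_
  simp only [Function.comp_apply, E, Equiv.coe_fn_mk]
  rw [Nat.sub_add_cancel ((hP _ _).1 f.2)]

end GapFunctions

/-! ### Descents as forced drops of the quotients. -/

namespace ColoredPerm

variable {n r : ℕ}

/-- Inversion and `bar` both negate colors, so the signs cancel and colors agree on 2-cycles. -/
theorem isAbsInvolution_iff [NeZero r] (w : ColoredPerm n r) :
    w.IsAbsInvolution ↔
      (∀ i, w.perm (w.perm i) = i) ∧ ∀ i, w.color (w.perm i) = w.color i := by
  have hinv : (w.bar)⁻¹ = ⟨w.perm⁻¹, fun i => - -w.color (w.perm⁻¹ i)⟩ := rfl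
  rw [IsAbsInvolution, hinv, ColoredPerm.ext_iff]
  simp only [neg_neg, funext_iff]
  constructor
  · rintro ⟨h1, h2⟩
    have hsymm : w.perm.symm = w.perm := h1
    refine ⟨fun i => ?_, fun i => ?_⟩
    · nth_rw 1 [← hsymm]
      exact w.perm.symm_apply_apply i
    · rw [← h2 i, h1]
  · rintro ⟨h1, h2⟩
    have hsymm : w.perm⁻¹ = w.perm := Equiv.ext fun i => by
      rw [Equiv.Perm.inv_eq_iff_eq, h1]
    exact ⟨hsymm, fun i => by rw [hsymm, h2]⟩

theorem mem_desSetStar {w : ColoredPerm n r} {i : ℕ} (h : i + 1 < n) :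
    i + 1 ∈ w.desSetStar ↔ ColorLT (w.window ⟨i + 1, h⟩) (w.window ⟨i, by omega⟩) := by
  simp only [desSetStar, Finset.mem_filter, Finset.mem_range]
  exact ⟨fun ⟨_, _, _, h'⟩ => h', fun h' => ⟨h, h, by omega, h'⟩⟩

theorem lt_of_mem_desSetStar {w : ColoredPerm n r} {i : ℕ} (h : i ∈ w.desSetStar) :
    1 ≤ i ∧ i < n := by
  simp only [desSetStar, Finset.mem_filter, Finset.mem_range] at h
  obtain ⟨h1, _, h2, _⟩ := h
  exact ⟨h2, h1⟩

/-- The least gap after position `i` of a sequence compatible with `w`: `1` at descents. -/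
noncomputable def descentGap (w : ColoredPerm n r) (i : Fin n) : ℕ :=
  if (i : ℕ) + 1 ∈ w.desSetStar then 1 else 0

/-- The label sequence of quotients `f` and remainders the colors of `w`. -/
def label (w : ColoredPerm n r) (f : Fin n → ℕ) (i : Fin n) : ℕ := r * f i + w.color i

/-- Labels compare first by quotient. For equal quotients the color decides, then the letter; since
larger colors come first in the color order, the condition then says exactly that there is no
descent. -/
theorem label_step_iff (w : ColoredPerm n r) (f : Fin n → ℕ) {i : ℕ} (h : i + 1 < n) :
    (w.label f ⟨i + 1, h⟩ < w.label f ⟨i, by omega⟩ ∨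
      (w.label f ⟨i, by omega⟩ = w.label f ⟨i + 1, h⟩ ∧
        w.perm ⟨i, by omega⟩ < w.perm ⟨i + 1, h⟩)) ↔
    f ⟨i + 1, h⟩ + w.descentGap ⟨i, by omega⟩ ≤ f ⟨i, by omega⟩ := by
  have hne : w.perm ⟨i, by omega⟩ ≠ w.perm ⟨i + 1, h⟩ := fun he => by
    have := Fin.ext_iff.1 (w.perm.injective he)
    simp at this
  have hmem := mem_desSetStar (w := w) h
  simp only [descentGap, label]
  simp only [ColorLT, window] at hmem
  generalize w.perm ⟨i, by omega⟩ = a at *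
  generalize w.perm ⟨i + 1, h⟩ = b at *
  generalize hc : w.color ⟨i, by omega⟩ = c at *
  generalize hd : w.color ⟨i + 1, h⟩ = d at *
  generalize f ⟨i, by omega⟩ = k at *
  generalize f ⟨i + 1, h⟩ = l at *
  rw [if_congr hmem rfl rfl]
  simp only [Fin.lt_def, Fin.ext_iff, ne_eq] at *
  have hcr := c.2
  have hdr := d.2
  rcases lt_trichotomy l k with hlk | rfl | hlk
  · have : r * (l + 1) ≤ r * k := Nat.mul_le_mul_left r hlk
    rw [mul_add, mul_one] at this
    split_ifs <;> omega
  · split_ifs <;> omega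
  · have : r * (k + 1) ≤ r * l := Nat.mul_le_mul_left r hlk
    rw [mul_add, mul_one] at this
    split_ifs <;> omega

theorem isLabelledInvolution_label_iff [NeZero r] (w : ColoredPerm n r) (f : Fin n → ℕ) :
    IsLabelledInvolution (residue r) w.perm (fun i => OrderDual.toDual (w.label f i)) ↔
      w.IsAbsInvolution ∧ ∀ i, nextValue f i + w.descentGap i ≤ f i := by
  have hres : ∀ i, residue r (OrderDual.toDual (w.label f i)) = w.color i := fun i => by
    rw [residue, OrderDual.ofDual_toDual, label, Nat.mul_add_mod, Nat.mod_eq_of_lt (w.color i).2]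
  have hstep : (∀ i j, i < j → OrderDual.toDual (w.label f i) < OrderDual.toDual (w.label f j) ∨
      (OrderDual.toDual (w.label f i) = OrderDual.toDual (w.label f j) ∧ w.perm i < w.perm j)) ↔
      ∀ i, nextValue f i + w.descentGap i ≤ f i := by
    -- As strict lexicographic monotonicity, the condition need only be checked at neighboring
    -- positions.
    have hlex : (∀ i j, i < j → OrderDual.toDual (w.label f i) < OrderDual.toDual (w.label f j) ∨
        (OrderDual.toDual (w.label f i) = OrderDual.toDual (w.label f j) ∧ w.perm i < w.perm j)) ↔
        StrictMono fun i => toLex (OrderDual.toDual (w.label f i), w.perm i) := by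
      simp only [StrictMono, Prod.Lex.toLex_lt_toLex]
    rw [hlex]
    rcases n with _ | n
    · exact ⟨fun _ i => i.elim0, fun _ i => i.elim0⟩
    · rw [Fin.strictMono_iff_lt_succ]
      simp only [Prod.Lex.toLex_lt_toLex]
      have key := fun i : Fin n => label_step_iff w f (i := i) (by omega)
      constructor
      · intro h i
        by_cases hi : (i : ℕ) < n
        · have := (key ⟨i, hi⟩).1 (h ⟨i, hi⟩)
          rw [nextValue, dif_pos (by omega)]
          exact this
        · have hi' : (i : ℕ) = n := by omega
          have hnot : ¬ (i : ℕ) + 1 ∈ w.desSetStar := fun hm =>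
            hi (by have := (lt_of_mem_desSetStar hm).2; omega)
          rw [nextValue, dif_neg (by omega), descentGap, if_neg hnot]
          exact Nat.zero_le _
      · intro h i
        have := h i.castSucc
        rw [nextValue, dif_pos (by simp)] at this
        exact (key i).2 this
  rw [isAbsInvolution_iff]
  constructor
  · rintro ⟨h1, h2, h3⟩
    refine ⟨⟨h1, fun i => ?_⟩, hstep.1 h3⟩
    have := h2 i
    rw [hres, hres] at this
    exact Fin.ext this
  · rintro ⟨⟨h1, h2⟩, h3⟩
    exact ⟨h1, fun i => by rw [hres, hres, h2], hstep.2 h3⟩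

theorem label_le_label_first {w : ColoredPerm n r} [NeZero r] (hw : w.IsAbsInvolution)
    (f : GapFunction w.descentGap) (M : ℕ) :
    (∀ i, w.label f.1 i ≤ M) ↔ r * firstValue f.1 + w.firstColor ≤ M := by
  have hmono := ((w.isLabelledInvolution_label_iff f.1).2 ⟨hw, f.2⟩).monotone
  rw [firstValue, firstColor]
  split_ifs with h
  · exact ⟨fun H => H ⟨0, h⟩, fun H i => le_trans (hmono (Fin.le_def.2 (Nat.zero_le _))) H⟩
  · exact ⟨fun _ => by simp, fun _ i => absurd i.pos h⟩

theorem prod_descentGap {A : Type*} [CommMonoid A] (w : ColoredPerm n r) (g : ℕ → A) :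
    ∏ i : Fin n, g ((i : ℕ) + 1) ^ w.descentGap i = ∏ j ∈ w.desSetStar, g j := by
  simp only [descentGap]
  rw [Fin.prod_univ_eq_prod_range (fun i => g (i + 1) ^ if i + 1 ∈ w.desSetStar then 1 else 0) n]
  simp only [pow_ite, pow_one, pow_zero]
  rw [← Finset.prod_filter]
  refine Finset.prod_bij' (fun i _ => i + 1) (fun j _ => j - 1) ?_ ?_ ?_ ?_ fun _ _ => rfl
  · exact fun i hi => (Finset.mem_filter.1 hi).2
  · intro j hj
    have := lt_of_mem_desSetStar hj
    rw [Finset.mem_filter, Finset.mem_range, Nat.sub_add_cancel this.1]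
    exact ⟨by omega, hj⟩
  · exact fun i _ => rfl
  · exact fun j hj => Nat.sub_add_cancel (lt_of_mem_desSetStar hj).1

theorem zero_notMem_desSetStar (w : ColoredPerm n r) : 0 ∉ w.desSetStar := fun h =>
  absurd (lt_of_mem_desSetStar h).1 (by omega)

theorem maj_eq (w : ColoredPerm n r) : w.maj = ∑ i ∈ w.desSetStar, i := by
  rw [maj, desSet]
  split_ifs
  · rfl
  · rw [Finset.sum_insert w.zero_notMem_desSetStar, zero_add]

theorem des_eq (w : ColoredPerm n r) :
    w.des = w.desSetStar.card + if w.firstColor = 0 then 0 else 1 := by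
  rw [des, desSet]
  split_ifs
  · rfl
  · rw [Finset.card_insert_of_notMem w.zero_notMem_desSetStar]

theorem prod_fixed {A : Type*} [CommMonoid A] (w : ColoredPerm n r) (p : Fin r → A) :
    (∏ i, if w.perm i = i then p (w.color i) else 1) = ∏ j, p j ^ w.fixCount j := by
  rw [← Finset.prod_filter, ← Finset.prod_fiberwise _ w.color]
  refine Finset.prod_congr rfl fun j _ => ?_
  rw [fixCount, ← Finset.prod_const, Finset.filter_filter]
  exact Finset.prod_congr rfl fun i hi => by rw [(Finset.mem_filter.1 hi).2.2]

end ColoredPerm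

/-! ### Comparison of the two evaluations. -/

section Assembly

/-- Sequences compatible with `w` whose labels are at most `M`. -/
abbrev BoundedGapFunction {n r : ℕ} (w : ColoredPerm n r) (M : ℕ) : Type :=
  {f : GapFunction w.descentGap // ∀ i, w.label f.1 i ≤ M}

instance {n r : ℕ} [NeZero r] (w : ColoredPerm n r) (M : ℕ) :
    Finite (BoundedGapFunction w M) := by
  have hle : ∀ (f : BoundedGapFunction w M) (i : Fin n), f.1.1 i < M + 1 := fun f i => by
    have h1 := f.2 i
    have h2 : f.1.1 i ≤ r * f.1.1 i := Nat.le_mul_of_pos_left _ (NeZero.pos r)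
    rw [ColoredPerm.label] at h1
    omega
  refine Finite.of_injective (β := Fin n → Fin (M + 1)) (fun f i => ⟨f.1.1 i, hle f i⟩) ?_
  intro f f' h
  simp only [funext_iff, Fin.mk.injEq] at h
  exact Subtype.ext (Subtype.ext (funext h))

noncomputable instance {n r : ℕ} [NeZero r] (w : ColoredPerm n r) (M : ℕ) :
    Fintype (BoundedGapFunction w M) := Fintype.ofFinite _

/-- The labelled involution of an absolute involution and a compatible sequence. -/
def toLabelledInvolution {n r M : ℕ} [NeZero r]
    (a : Σ w : {w : ColoredPerm n r // w.IsAbsInvolution}, BoundedGapFunction w.1 M) :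
    LabelledInvolution (residue r) (labelsUpTo M) n :=
  ⟨(a.1.1.perm, fun i => OrderDual.toDual (a.1.1.label a.2.1.1 i)),
    (a.1.1.isLabelledInvolution_label_iff _).2 ⟨a.1.2, a.2.1.2⟩,
    fun i => mem_labelsUpTo.2 (a.2.2 i)⟩

/-- Division with remainder by r splits each label uniquely into quotient and color. -/
theorem toLabelledInvolution_bijective {n r M : ℕ} [NeZero r] :
    Function.Bijective (toLabelledInvolution : (Σ w : {w : ColoredPerm n r // w.IsAbsInvolution},
      BoundedGapFunction w.1 M) → _) := by
  have hr : 0 < r := NeZero.pos r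
  constructor
  · rintro ⟨⟨w, hw⟩, ⟨f, hf⟩, hfM⟩ ⟨⟨w', hw'⟩, ⟨f', hf'⟩, hfM'⟩ h
    have h1 : w.perm = w'.perm := congrArg (fun t => t.1.1) h
    have h2 : ∀ i, w.label f i = w'.label f' i := fun i =>
      congrArg OrderDual.ofDual (congrFun (congrArg (fun t => t.1.2) h) i)
    have hc : w.color = w'.color := funext fun i => Fin.ext (by
      have := congrArg (· % r) (h2 i)
      simpa [ColoredPerm.label, Nat.mul_add_mod, Nat.mod_eq_of_lt] using this)
    obtain rfl : w = w' := ColoredPerm.ext h1 hc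
    obtain rfl : f = f' := funext fun i =>
      Nat.eq_of_mul_eq_mul_left hr (Nat.add_right_cancel (h2 i))
    rfl
  · rintro ⟨⟨π, F⟩, h, hB⟩
    let w : ColoredPerm n r := ⟨π, fun i => Fin.ofNat r (OrderDual.ofDual (F i))⟩
    let f : Fin n → ℕ := fun i => OrderDual.ofDual (F i) / r
    have hF : (fun i => OrderDual.toDual (w.label f i)) = F :=
      funext fun i => congrArg OrderDual.toDual (Nat.div_add_mod (OrderDual.ofDual (F i)) r)
    have h' := (w.isLabelledInvolution_label_iff f).1 (by rw [hF]; exact h)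
    refine ⟨⟨⟨w, h'.1⟩, ⟨f, h'.2⟩, fun i => ?_⟩, ?_⟩
    · have := mem_labelsUpTo.1 (hB i)
      rw [← hF] at this
      exact this
    · exact Subtype.ext (Prod.ext rfl hF)

open Classical in
theorem labelledSum_eq {A : Type*} [CommRing A] (n r M : ℕ) [NeZero r] (q : A) (p : Fin r → A) :
    labelledSum n r M q p = ∑ w : {w : ColoredPerm n r // w.IsAbsInvolution},
      q ^ w.1.csum * (∏ j, p j ^ w.1.fixCount j) *
        ∑ f : BoundedGapFunction w.1 M, (q ^ r) ^ ∑ i, f.1.1 i := by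
  simp only [Finset.mul_sum]
  rw [← Fintype.sum_sigma', labelledSum,
    ← (toLabelledInvolution_bijective (n := n) (r := r) (M := M)).sum_comp]
  refine Finset.sum_congr rfl fun a _ => ?_
  obtain ⟨⟨w, hw⟩, f⟩ := a
  simp only [toLabelledInvolution, OrderDual.ofDual_toDual]
  have hcol : ∀ i, Fin.ofNat r (w.label f.1.1 i) = w.color i := fun i => Fin.ext (by
    simp [ColoredPerm.label, Fin.ofNat, Nat.mod_eq_of_lt])
  simp only [hcol]
  rw [Finset.prod_mul_distrib, w.prod_fixed, Finset.prod_pow_eq_pow_sum]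
  simp only [ColoredPerm.label]
  rw [Finset.sum_add_distrib, ← Finset.mul_sum, pow_add, pow_mul, ColoredPerm.csum]
  ring

variable {σ R : Type*} [CommRing R]

theorem recip_qPoch_succ {x Q : MvPowerSeries σ R} (hx : IsProperMonomial x)
    (hQ : IsProperMonomial Q) (n : ℕ) :
    recip (qPoch x Q (n + 1)) =
      recip (1 - x) * ∏ i : Fin n, recip (1 - x * Q ^ ((i : ℕ) + 1)) := by
  rw [qPoch, recip_prod _ _ fun k _ => (hx.mul_pow hQ k).constantCoeff_one_sub,
    Finset.prod_range_succ', pow_zero, mul_one, mul_comm,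
    ← Fin.prod_univ_eq_prod_range (fun i => recip (1 - x * Q ^ (i + 1))) n]

theorem geom_sum_mul_recip {x : MvPowerSeries σ R} (hx : IsProperMonomial x) {r : ℕ}
    (hr : r ≠ 0) : (∑ i ∈ Finset.range r, x ^ i) * recip (1 - x ^ r) = recip (1 - x) := by
  refine (recip_eq_of_mul_eq_one hx.constantCoeff_one_sub ?_).symm
  rw [← mul_assoc, mul_neg_geom_sum, mul_recip (hx.pow hr).constantCoeff_one_sub]

variable [TopologicalSpace R]

/-- The exponents of the two indeterminates in `d` bound both indices, whatever `P` is. -/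
theorem summable_X_pow_mul_X_pow_mul (s t : σ) (P : ℕ → ℕ → MvPowerSeries σ R) :
    Summable fun a : ℕ × ℕ => MvPowerSeries.X s ^ a.2 * (MvPowerSeries.X t ^ a.1 * P a.1 a.2) := by
  refine MvPowerSeries.summable_of_finite_coeff_ne_zero fun d => ?_
  refine (Set.finite_Iic (d t, d s)).subset fun a ha => ?_
  refine Prod.mk_le_mk.2 ⟨?_, ?_⟩ <;> by_contra hlt <;> refine ha ?_
  · exact MvPowerSeries.X_pow_dvd_iff.1
      ((Dvd.intro _ rfl).mul_left (MvPowerSeries.X s ^ a.2)) d (not_le.1 hlt)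
  · exact MvPowerSeries.X_pow_dvd_iff.1 (Dvd.intro _ rfl) d (not_le.1 hlt)

theorem exists_hasSum_of_double {T : Type*} [AddCommGroup T] [TopologicalSpace T]
    [IsTopologicalAddGroup T] [RegularSpace T] {f : ℕ × ℕ → T} (hf : Summable f) {a b : ℕ → T}
    (ha : ∀ n, HasSum (fun m => f (n, m)) (a n)) (hb : ∀ m, HasSum (fun n => f (n, m)) (b m)) :
    ∃ S, HasSum a S ∧ HasSum b S := by
  obtain ⟨S, hS⟩ := hf
  refine ⟨S, hS.prod_fiberwise ha, ?_⟩
  rw [← (Equiv.prodComm ℕ ℕ).hasSum_iff] at hS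
  exact hS.prod_fiberwise hb

variable [DiscreteTopology R]

open Classical in
-- Common core of both versions: `s` is the weight of a descent and `h` the contribution of the
-- first color, as dictated by the label bound through `hM`.
theorem hasSum_absInvolution {n r : ℕ} [NeZero r] {x q : MvPowerSeries σ R}
    (hx : IsProperMonomial x) (hq : IsProperMonomial q) (p : Fin r → MvPowerSeries σ R) {s : ℕ}
    (hs : s ≠ 0) (h : ColoredPerm n r → ℕ) (M : ℕ → ℕ)
    (hM : ∀ w : ColoredPerm n r, w.IsAbsInvolution → ∀ (f : GapFunction w.descentGap) (m : ℕ),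
      (∀ i, w.label f.1 i ≤ M m) ↔ s * firstValue f.1 + h w ≤ m) :
    HasSum (fun m => x ^ m * labelledSum n r (M m) q p)
      ((∑ w : ColoredPerm n r with w.IsAbsInvolution, x ^ (s * w.desSetStar.card + h w) *
        q ^ w.fmaj * ∏ j, p j ^ w.fixCount j) *
        (recip (1 - x) * ∏ i : Fin n, recip (1 - x ^ s * (q ^ r) ^ ((i : ℕ) + 1)))) := by
  simp only [labelledSum_eq, Finset.mul_sum _ _ (x ^ _)]
  rw [Finset.sum_mul, Finset.sum_subtype (p := fun w : ColoredPerm n r => w.IsAbsInvolution)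
    (Finset.univ.filter _) (fun w => by simp)]
  refine hasSum_sum fun w _ => ?_
  have H := hasSum_boundedGapFunction hx (hq.pow (NeZero.ne r)) hs (h w.1) w.1.descentGap
    (fun m f => ∀ i, w.1.label f.1 i ≤ M m) (fun m f => hM w.1 w.2 f m)
  rw [w.1.prod_descentGap fun j => x ^ s * (q ^ r) ^ j, Finset.prod_mul_distrib,
    Finset.prod_const, Finset.prod_pow_eq_pow_sum, ← w.1.maj_eq] at H
  have H' := H.mul_left (q ^ w.1.csum * ∏ j, p j ^ w.1.fixCount j)
  convert H' using 1
  · rfl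
  · funext m
    ring
  · rw [ColoredPerm.fmaj, pow_add, pow_add, pow_mul, pow_mul]
    ring

theorem absInvPoly_hasSum {n r : ℕ} [NeZero r] {x q : MvPowerSeries σ R}
    (hx : IsProperMonomial x) (hq : IsProperMonomial q) (p : Fin r → MvPowerSeries σ R) :
    HasSum (fun m => x ^ m * labelledSum n r (r * m) q p)
      (absInvPoly n r x q p * recip (qPoch x (q ^ r) (n + 1))) := by
  have hr : 0 < r := NeZero.pos r
  -- With k the first quotient and c the first color, rk + c ≤ rm means k ≤ m if c = 0 and k + 1 ≤ m
  -- otherwise: this is the descent at 0.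
  have H := hasSum_absInvolution (n := n) hx hq p one_ne_zero
    (fun w => if w.firstColor = 0 then 0 else 1) (fun m => r * m) (by
      intro w hw f m
      rw [w.label_le_label_first hw, one_mul]
      have hc : w.firstColor < r := by
        rw [ColoredPerm.firstColor]
        split_ifs
        exacts [Fin.is_lt _, hr]
      generalize firstValue f.1 = k
      generalize w.firstColor = c at hc
      constructor
      · intro hle
        split_ifs with h0
        · rw [add_zero]
          exact Nat.le_of_mul_le_mul_left (by omega) hr
        · exact Nat.lt_of_mul_lt_mul_left (a := r) (by omega)
      · intro hle
        split_ifs at hle with h0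
        · have := Nat.mul_le_mul_left r hle
          rw [mul_add] at this
          omega
        · have := Nat.mul_le_mul_left r hle
          rw [mul_add] at this
          omega)
  rw [recip_qPoch_succ hx (hq.pow hr.ne'), absInvPoly]
  simpa only [ColoredPerm.des_eq, one_mul, pow_one] using H

theorem absInvPolyFlag_hasSum {n r : ℕ} [NeZero r] {x q : MvPowerSeries σ R}
    (hx : IsProperMonomial x) (hq : IsProperMonomial q) (p : Fin r → MvPowerSeries σ R) :
    HasSum (fun m => x ^ m * labelledSum n r m q p)
      ((∑ i ∈ Finset.range r, x ^ i) * absInvPolyFlag n r x q p *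
        recip (qPoch (x ^ r) (q ^ r) (n + 1))) := by
  have hr : r ≠ 0 := NeZero.ne r
  have H := hasSum_absInvolution (n := n) hx hq p hr (fun w => w.firstColor) (fun m => m)
    (fun w hw f m => w.label_le_label_first hw f m)
  rw [recip_qPoch_succ (hx.pow hr) (hq.pow hr), absInvPolyFlag]
  convert H using 1
  -- The slack gives 1/(1 - x) = [r]_x/(1 - x^r), the source of the factor [r]_x.
  rw [← geom_sum_mul_recip hx hr]
  simp only [ColoredPerm.fdes]
  ring

end Assembly

/-- `R` is discrete and `R⟦x, q, z, p₀, …, p_{r-1}⟧` has the topology of coefficientwise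
convergence, so that the infinite sums are sums of formal power series.
For `c < r`, `(m + r - c) / r` is `⌊(m - c) / r⌋ + 1`. -/
theorem corollary4p9 {R : Type*} [CommRing R] [TopologicalSpace R] [DiscreteTopology R]
    (r : ℕ) [NeZero r] (x q z : MvPowerSeries (Var r) R) (p : Fin r → MvPowerSeries (Var r) R)
    (hx : x = MvPowerSeries.X Var.x) (hq : q = MvPowerSeries.X Var.q)
    (hz : z = MvPowerSeries.X Var.z) (hp : ∀ c, p c = MvPowerSeries.X (Var.p c)) :
    (∃ S : MvPowerSeries (Var r) R,
      HasSum (fun n : ℕ => absInvPoly n r x q p * recip (qPoch x (q ^ r) (n + 1)) * z ^ n) S ∧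
      HasSum (fun m : ℕ =>
        recip (qPoch (p 0 * z) (q ^ r) (m + 1)) * recip (pairProd r 0 z q (m + 1)) *
          (∏ c : Fin r with c ≠ 0,
            recip (qPoch (p c * q ^ (c : ℕ) * z) (q ^ r) m) * recip (pairProd r c z q m)) *
          x ^ m) S) ∧
    (∃ S : MvPowerSeries (Var r) R,
      HasSum (fun n : ℕ => (∑ i ∈ Finset.range r, x ^ i) * absInvPolyFlag n r x q p *
        recip (qPoch (x ^ r) (q ^ r) (n + 1)) * z ^ n) S ∧
      HasSum (fun m : ℕ =>
        recip (qPoch (p 0 * z) (q ^ r) (m / r + 1)) * recip (pairProd r 0 z q (m / r + 1)) *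
          (∏ c : Fin r with c ≠ 0,
            recip (qPoch (p c * q ^ (c : ℕ) * z) (q ^ r) ((m + r - c) / r)) *
              recip (pairProd r c z q ((m + r - c) / r))) *
          x ^ m) S) := by
  have hx' : IsProperMonomial x := hx ▸ isProperMonomial_X _
  have hq' : IsProperMonomial q := hq ▸ isProperMonomial_X _
  have hz' : IsProperMonomial z := hz ▸ isProperMonomial_X _
  have hp' : ∀ c, IsProperMonomial (p c) := fun c => hp c ▸ isProperMonomial_X _
  have hr : 0 < r := NeZero.pos r
  have hrhs := fun M => hasSum_labelledSum hq' hz' hp' M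
  have hsplit : ∀ M, ∏ c : Fin r,
      recip (qPoch (p c * q ^ (c : ℕ) * z) (q ^ r) ((M + r - c) / r)) *
        recip (pairProd r c z q ((M + r - c) / r)) =
      recip (qPoch (p 0 * z) (q ^ r) (M / r + 1)) * recip (pairProd r 0 z q (M / r + 1)) *
        ∏ c : Fin r with c ≠ 0,
          recip (qPoch (p c * q ^ (c : ℕ) * z) (q ^ r) ((M + r - c) / r)) *
            recip (pairProd r c z q ((M + r - c) / r)) := by
    intro M
    rw [Finset.filter_ne', ← Finset.mul_prod_erase Finset.univ _ (Finset.mem_univ (0 : Fin r)),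
      Fin.val_zero, pow_zero, mul_one, Nat.sub_zero, Nat.add_div_right _ hr]
  simp only [hsplit] at hrhs
  constructor
  · refine exists_hasSum_of_double
      (f := fun a => x ^ a.2 * (z ^ a.1 * labelledSum a.1 r (r * a.2) q p)) ?_ (fun n => ?_)
      (fun m => ?_)
    · rw [hx, hz]
      exact summable_X_pow_mul_X_pow_mul _ _ fun n m => labelledSum n r (r * m) q p
    · refine ((absInvPoly_hasSum hx' hq' p).mul_right (z ^ n)).congr_fun fun m => ?_
      ring
    · have hprod : ∏ c : Fin r with c ≠ 0,
          recip (qPoch (p c * q ^ (c : ℕ) * z) (q ^ r) ((r * m + r - c) / r)) *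
            recip (pairProd r c z q ((r * m + r - c) / r)) =
          ∏ c : Fin r with c ≠ 0,
            recip (qPoch (p c * q ^ (c : ℕ) * z) (q ^ r) m) * recip (pairProd r c z q m) := by
        refine Finset.prod_congr rfl fun c hc => ?_
        have hc0 : (c : ℕ) ≠ 0 := fun h0 => (Finset.mem_filter.1 hc).2 (Fin.ext h0)
        -- Up to rm a nonzero residue has m labels, one fewer than residue 0.
        have hdiv : (r * m + r - c) / r = m := by
          have := c.2
          rw [Nat.div_eq_iff hr, mul_comm m r]
          omega
        rw [hdiv]
      have H := hrhs (r * m)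
      rw [hprod, Nat.mul_div_cancel_left _ hr] at H
      exact (H.mul_right (x ^ m)).congr_fun fun n => mul_comm _ _
  · refine exists_hasSum_of_double
      (f := fun a => x ^ a.2 * (z ^ a.1 * labelledSum a.1 r a.2 q p)) ?_ (fun n => ?_)
      (fun m => ?_)
    · rw [hx, hz]
      exact summable_X_pow_mul_X_pow_mul _ _ fun n m => labelledSum n r m q p
    · refine ((absInvPolyFlag_hasSum hx' hq' p).mul_right (z ^ n)).congr_fun fun m => ?_
      ring
    · exact ((hrhs m).mul_right (x ^ m)).congr_fun fun n => mul_comm _ _
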